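/- Let $m, r$ be positive integers, $n = mr$, let $d$ be a non-negative integer, and let $\mathbf t = (1,2,\dots,m)$. Let $\mathcal M$ be the set of $r$-regular multipermutation matrices, i.e. $m\times n$ matrices $X$ with entries in $\{0,1\}$, all column sums equal to $1$ and all row sums equal to $r$; each $X\in\mathcal M$ represents the multipermutation $\mathbf tX$. Let $\mathbf y$ be a fixed $r$-regular multipermutation, i.e. an arrangement $(y_1,\dots,y_n)$ of the multiset in which each of $1,\dots,m$ occurs exactly $r$ times, and let $d_\infty(\mathbf x,\mathbf y)=\max_j|x_j-y_j|$ be the Chebyshev distance. Fixed-at-zero constraints: for an integer $0\le\kappa\le mn$, let $\mathcal S^z(\kappa)$ be the family of all sets $\mathcal Z$ of $\kappa$ distinct entries $(i,j)$ of an $m\times n$ matrix, and let $\mathcal M(\mathcal Z)$ be the set of $X\in\mathcal M$ with $X_{ij}=0$ for all $(i,j)\in\mathcal Z$. Fixed-at-equality constraints: for an integer $0\le\iota\le\binom{nm}{2}$, let $\mathcal S^e(\iota)$ be the family of all sets $\mathcal E$ of $\iota$ distinct unordered pairs of two different entries of an $m\times n$ matrix, and let $\mathcal M(\mathcal E)$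 be the set of $X\in\mathcal M$ with $X_{ij}=X_{kl}$ for every pair $\{(i,j),(k,l)\}\in\mathcal E$. For a set $\mathcal C$ of matrices put $L_d(\mathcal C)=|\{X\in\mathcal C : d_\infty(\mathbf tX,\mathbf y)\le d\}|$. Then, for $\mathcal Z$ uniformly distributed on $\mathcal S^z(\kappa)$, $$\frac{\binom{mn-n}{\kappa}}{|\mathcal S^z(\kappa)|}\cdot\frac{(2dr+r)^n\,n!}{2^{2dr}\,n^n\,(r!)^m}\;\le\;\mathbb E[L_d(\mathcal M(\mathcal Z))]\;\le\;\frac{\binom{mn-n}{\kappa}}{|\mathcal S^z(\kappa)|}\cdot\frac{[(2dr+r)!]^{\frac{n}{2dr+r}}}{(r!)^m},$$ and, for $\mathcal E$ uniformly distributed on $\mathcal S^e(\iota)$, $$\frac{\binom{\binom{nm-n}{2}+\binom n2}{\iota}}{|\mathcal S^e(\iota)|}\cdot\frac{(2dr+r)^n\,n!}{2^{2dr}\,n^n\,(r!)^m}\;\le\;\mathbb E[L_d(\mathcal M(\mathcal E))]\;\le\;\frac{\binom{\binom{nm-n}{2}+\binom n2}{\iota}}{|\mathcal S^e(\iota)|}\cdot\frac{[(2dr+r)!]^{\frac{n}{2dr+r}}}{(r!)^m}.$$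 -/

import Mathlib

open scoped Nat Matrix BigOperators

noncomputable section

/-- The initial vector `(1, 2, …, m)`. -/
def initialVector (m : ℕ) : Fin m → ℝ := fun i => (i : ℝ) + 1

/-- The multipermutations of length `n` with values `t i` of multiplicity `r i`: all arrangements of
the multiset in which `t i` occurs `r i` times. -/
def multipermutations {m n : ℕ} (r : Fin m → ℕ) (t : Fin m → ℝ) : Set (Fin n → ℝ) :=
  {y | (Finset.univ : Finset (Fin n)).val.map y = ∑ i, Multiset.replicate (r i) (t i)}

/-- The `m × n` multipermutation matrices with multiplicity vector `r`: binary matrices whose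
column sums are `1` and whose `i`-th row sum is `r i`. -/
def multipermutationMatrices {m n : ℕ} (r : Fin m → ℕ) : Set (Matrix (Fin m) (Fin n) ℝ) :=
  {X | (∀ i j, X i j = 0 ∨ X i j = 1) ∧ (∀ j, ∑ i, X i j = 1) ∧ ∀ i, ∑ j, X i j = r i}

/-- Multipermutation matrices subject to the fixed-at-zero constraints `Z`. -/
def zeroConstrained {m n : ℕ} (r : Fin m → ℕ) (Z : Finset (Fin m × Fin n)) :
    Set (Matrix (Fin m) (Fin n) ℝ) :=
  {X | X ∈ multipermutationMatrices r ∧ ∀ p ∈ Z, X p.1 p.2 = 0}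

/-- Multipermutation matrices subject to the fixed-at-equality constraints `E`, each constraint
being an unordered pair of entries. -/
def equalityConstrained {m n : ℕ} (r : Fin m → ℕ) (E : Finset (Sym2 (Fin m × Fin n))) :
    Set (Matrix (Fin m) (Fin n) ℝ) :=
  {X | X ∈ multipermutationMatrices r ∧
    ∀ p q : Fin m × Fin n, s(p, q) ∈ E → X p.1 p.2 = X q.1 q.2}

/-- All sets of `κ` distinct entries of an `m × n` matrix. -/
def zeroConstraintSets (m n κ : ℕ) : Finset (Finset (Fin m × Fin n)) :=
  Finset.powersetCard κ Finset.univ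

/-- All sets of `ι` distinct unordered pairs of two different entries of an `m × n` matrix. -/
def equalityConstraintSets (m n ι : ℕ) : Finset (Finset (Sym2 (Fin m × Fin n))) :=
  Finset.powersetCard ι {e | ¬ e.IsDiag}

/-- The Chebyshev distance `max_j |x_j - y_j|`. -/
def chebyshevDist {n : ℕ} (x y : Fin n → ℝ) : ℝ := ⨆ j, |x j - y j|

theorem chebyshevDist_eq_dist {n : ℕ} (x y : Fin n → ℝ) : chebyshevDist x y = dist x y := by
  unfold chebyshevDist
  apply le_antisymm
  · exact Real.iSup_le (fun j => dist_le_pi_dist x y j) dist_nonneg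
  · refine (dist_pi_le_iff (Real.iSup_nonneg fun j => abs_nonneg _)).2 fun j => ?_
    exact le_ciSup (f := fun j => |x j - y j|) (Set.finite_range _).bddAbove j

/-- The number of matrices `X` in `C` for which the codeword `t X` is within Chebyshev
distance `d` of `y`. -/
def ballCount {m n : ℕ} (t : Fin m → ℝ) (y : Fin n → ℝ) (d : ℕ)
    (C : Set (Matrix (Fin m) (Fin n) ℝ)) : ℕ :=
  Set.ncard {X | X ∈ C ∧ chebyshevDist (t ᵥ* X) y ≤ d}

/-- There are finitely many multipermutation matrices, so that `Set.ncard` counts them. -/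
theorem multipermutationMatrices_finite {m n : ℕ} (r : Fin m → ℕ) :
    (multipermutationMatrices r : Set (Matrix (Fin m) (Fin n) ℝ)).Finite := by
  have h : (Set.pi Set.univ fun _ : Fin m => Set.pi Set.univ fun _ : Fin n =>
      ({0, 1} : Set ℝ)).Finite :=
    Set.Finite.pi fun _ => Set.Finite.pi fun _ => Set.toFinite _
  exact h.subset fun X hX i _ j _ => by simpa using hX.1 i j

theorem card_zeroConstraintSets (m n κ : ℕ) :
    (zeroConstraintSets m n κ).card = (n * m).choose κ := by
  simp [zeroConstraintSets, Finset.card_powersetCard, Nat.mul_comm]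

theorem card_equalityConstraintSets (m n ι : ℕ) :
    (equalityConstraintSets m n ι).card = ((n * m).choose 2).choose ι := by
  rw [equalityConstraintSets, Finset.card_powersetCard, ← Fintype.card_subtype,
    Sym2.card_subtype_not_diag]
  simp [Nat.mul_comm]

end

/-!
The average over constraint sets is a double count. Every multipermutation matrix has `n` ones and
`m n - n` zeros, so it satisfies the same number of constraint sets of a given size as any other
(`card_zeroConstraintSets_filter`, `card_equalityConstraintSets_filter`). By `expect_ballCount` the
expectation is therefore the claimed binomial fraction times the number of all multipermutation
matrices in the Chebyshev ball, and it remains to bound that number.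

Writing the centre as a map `g` with fibres of size `r`, every multipermutation is `g ∘ σ` for
exactly `(r!) ^ m` permutations `σ`. Hence `(r!) ^ m` times the ball size is the permanent of the
binary `n × n` matrix with a one at `(a, b)` when `|g a - g b| ≤ d` (`permCount_eq_mul_ballCount`).
Its row sums are at most `2 d r + r`, and the upper bound is Bregman's theorem
(`log_permCount_le`, `permCount_le_rpow`), proved by Schrijver's induction.

For the lower bound with `d ≤ m`, the band is folded back at its two ends (`foldedBand`). This gives
a matrix with all row and column sums `2 d r + r`, whose permanent the van der Waerden bound
(`Matrix.le_permanent_of_nonneg`) estimates from below; folding increases the permanent by a factor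
of at most `2 ^ (2 d r)`. For `d ≥ m` the ball is everything, and an elementary inequality suffices.

The van der Waerden bound is proved by Gurvits' method. The product of the linear forms given by the
rows is a homogeneous polynomial without zeros in the right half-space, and its coefficient at
`x₁ ⋯ xₙ` is the permanent. Taking the linear coefficient in one variable preserves this stability
and loses a factor of at most `(k / (k + 1)) ^ k` in the lower bound by a multiple of the product of
the variables (`MvPolynomial.IsStrictlyStable.le_coeff_one`), because on positive points the
univariate restrictions have only negative real roots
(`Polynomial.le_coeff_one_of_roots_neg`). The factors multiply to `n! / nⁿ`.
-/

/-! ### Univariate polynomials with negative roots -/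

/-- At the origin, a nonconstant complex polynomial with all roots in the open left half plane has
nonzero derivative, because the logarithmic derivative there is a sum of numbers with positive real
part. -/
theorem Polynomial.coeff_one_ne_zero_of_roots_re_neg {P : Polynomial ℂ} (hdeg : 0 < P.natDegree)
    (hroot : ∀ t : ℂ, 0 ≤ t.re → P.eval t ≠ 0) : P.coeff 1 ≠ 0 := by
  have hP0 : P ≠ 0 := by rintro rfl; simp at hdeg
  have hspl : P.Splits := IsAlgClosed.splits P
  have h0 : P.eval 0 ≠ 0 := hroot 0 (by simp)
  have hlog := hspl.eval_derivative_div_eval_of_ne_zero h0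
  have hder : Polynomial.eval 0 (Polynomial.derivative P) = P.coeff 1 := by
    rw [← Polynomial.coeff_zero_eq_eval_zero, Polynomial.coeff_derivative]; simp
  intro h1
  rw [hder, h1, zero_div] at hlog
  have hneg : ∀ z ∈ P.roots, z.re < 0 := by
    intro z hz
    by_contra hc
    exact hroot z (not_lt.1 hc) ((Polynomial.mem_roots hP0).1 hz)
  have hpos : ∀ s : Multiset ℂ, (∀ z ∈ s, z.re < 0) → 0 < s.card →
      0 < ((s.map fun z => 1 / (0 - z)).sum).re := by
    intro s
    induction s using Multiset.induction_on with
    | empty => simp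
    | cons a s ih =>
      intro hs _
      have ha : 0 < (1 / (0 - a)).re := by
        have hlt := hs a (by simp)
        have hne : (-a) ≠ 0 := by
          intro h; rw [neg_eq_zero] at h; rw [h] at hlt; simp at hlt
        rw [zero_sub, one_div, Complex.inv_re]
        exact div_pos (by simpa using hlt) (Complex.normSq_pos.2 hne)
      rw [Multiset.map_cons, Multiset.sum_cons, Complex.add_re]
      rcases Multiset.empty_or_exists_mem s with rfl | ⟨b, hb⟩
      · simpa using ha
      · exact add_pos ha (ih (fun z hz => hs z (by simp [hz]))
          (Multiset.card_pos_iff_exists_mem.2 ⟨b, hb⟩))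
  have := hpos P.roots hneg (by rw [← hspl.natDegree_eq_card_roots]; exact hdeg)
  rw [← hlog] at this
  simp at this

/-- A real polynomial all of whose complex roots are negative reals is a constant times a product
of factors `X + a` with `a > 0`. -/
theorem Polynomial.exists_eq_prod_X_add_C {P : Polynomial ℝ}
    (hroot : ∀ t : ℂ, (P.map (algebraMap ℝ ℂ)).eval t = 0 → t.re < 0 ∧ t.im = 0) :
    ∃ s : Multiset ℝ, (∀ a ∈ s, 0 < a) ∧ s.card = P.natDegree ∧
      P = Polynomial.C P.leadingCoeff * (s.map fun a => Polynomial.X + Polynomial.C a).prod := by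
  set Q := P.map (algebraMap ℝ ℂ) with hQ
  by_cases hP0 : P = 0
  · exact ⟨0, by simp, by simp [hP0], by simp [hP0]⟩
  have hQ0 : Q ≠ 0 := by
    rw [hQ, Ne, Polynomial.map_eq_zero_iff (algebraMap ℝ ℂ).injective]; exact hP0
  have hspl : Q.Splits := IsAlgClosed.splits Q
  refine ⟨Q.roots.map fun z => -z.re, ?_, ?_, ?_⟩
  · intro a ha
    obtain ⟨z, hz, rfl⟩ := Multiset.mem_map.1 ha
    have := (hroot z ((Polynomial.mem_roots hQ0).1 hz)).1
    linarith
  · rw [Multiset.card_map, ← hspl.natDegree_eq_card_roots, hQ, Polynomial.natDegree_map]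
  · apply Polynomial.map_injective _ (algebraMap ℝ ℂ).injective
    rw [← hQ, Polynomial.map_mul, Polynomial.map_C, Polynomial.map_multiset_prod, Multiset.map_map,
      Multiset.map_map]
    conv_lhs => rw [hspl.eq_prod_roots]
    congr 1
    · rw [hQ, Polynomial.leadingCoeff_map]
    · congr 1
      apply Multiset.map_congr rfl
      intro z hz
      have := (hroot z ((Polynomial.mem_roots hQ0).1 hz)).2
      have hz' : ((z.re : ℝ) : ℂ) = z := Complex.ext (by simp) (by simp [this])
      simp [hz', sub_eq_add_neg]

/-- The derivative at the origin of `∏ (X + a)`. -/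
theorem Polynomial.coeff_one_prod_X_add_C (s : Multiset ℝ) (hs : ∀ a ∈ s, 0 < a) :
    (s.map fun a => Polynomial.X + Polynomial.C a).prod.coeff 1 =
      s.prod * (s.map fun a => a⁻¹).sum := by
  have h0 : ∀ s : Multiset ℝ,
      (s.map fun a => Polynomial.X + Polynomial.C a).prod.coeff 0 = s.prod := by
    intro s
    rw [Polynomial.coeff_zero_eq_eval_zero, Polynomial.eval_multiset_prod]
    simp
  induction s using Multiset.induction_on with
  | empty => simp [Polynomial.coeff_one]
  | cons a s ih =>
    have ha : a ≠ 0 := (hs a (by simp)).ne'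
    rw [Multiset.map_cons, Multiset.prod_cons, add_mul, Polynomial.coeff_add,
      Polynomial.coeff_X_mul, Polynomial.coeff_C_mul, h0, ih fun b hb => hs b (by simp [hb])]
    simp only [Multiset.prod_cons, Multiset.map_cons, Multiset.sum_cons]
    field_simp

/-- The inequality between the arithmetic and geometric means, in the form needed for the factors
`t + a = a (1 + t / a)`. -/
theorem Multiset.prod_add_le_prod_mul_pow (s : Multiset ℝ) (hs : ∀ a ∈ s, 0 < a)
    (hcard : 0 < s.card) {t : ℝ} (ht : 0 < t) :
    (s.map fun a => t + a).prod ≤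
      s.prod * (1 + t * (s.map fun a => a⁻¹).sum / s.card) ^ s.card := by
  have hS : 0 ≤ (s.map fun a => a⁻¹).sum := by
    apply Multiset.sum_nonneg
    intro x hx
    obtain ⟨a, ha, rfl⟩ := Multiset.mem_map.1 hx
    exact (inv_pos.2 (hs a ha)).le
  set N : ℝ := ((s.card : ℕ) : ℝ) with hN
  have hNpos : 0 < N := by rw [hN]; exact_mod_cast hcard
  set M : ℝ := 1 + t * (s.map fun a => a⁻¹).sum / N with hM
  have hMpos : 0 < M := by positivity
  -- each factor is compared with an exponential through `x ≤ exp (x - 1)`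
  have key : ∀ s : Multiset ℝ, (∀ a ∈ s, 0 < a) → 0 < s.prod ∧ (s.map fun a => t + a).prod ≤
      s.prod * (M ^ s.card *
        Real.exp ((s.card + t * (s.map fun a => a⁻¹).sum) / M - s.card)) := by
    intro s
    induction s using Multiset.induction_on with
    | empty => simp
    | cons a s ih =>
      intro hs
      have ha : 0 < a := hs a (by simp)
      obtain ⟨ih0, ih1⟩ := ih fun b hb => hs b (by simp [hb])
      refine ⟨by rw [Multiset.prod_cons]; positivity, ?_⟩
      have hfac : t + a ≤ a * (M * Real.exp ((1 + t * a⁻¹) / M - 1)) := by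
        have := Real.add_one_le_exp ((1 + t * a⁻¹) / M - 1)
        calc t + a = a * (M * ((1 + t * a⁻¹) / M - 1 + 1)) := by field_simp; ring
          _ ≤ _ := by gcongr
      rw [Multiset.map_cons, Multiset.prod_cons, Multiset.prod_cons]
      calc (t + a) * (s.map fun a => t + a).prod
          ≤ (a * (M * Real.exp ((1 + t * a⁻¹) / M - 1))) * (s.prod * (M ^ s.card *
            Real.exp ((s.card + t * (s.map fun a => a⁻¹).sum) / M - s.card))) := by
              apply mul_le_mul hfac ih1 _ (by positivity)
              apply Multiset.prod_nonneg
              intro x hx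
              obtain ⟨b, hb, rfl⟩ := Multiset.mem_map.1 hx
              have := hs b (by simp [hb])
              positivity
        _ = a * s.prod * (M ^ (s.card + 1) * (Real.exp ((1 + t * a⁻¹) / M - 1) *
            Real.exp ((s.card + t * (s.map fun a => a⁻¹).sum) / M - s.card))) := by ring
        _ = _ := by
              rw [← Real.exp_add, Multiset.card_cons, Multiset.map_cons, Multiset.sum_cons]
              push_cast
              congr 3
              ring
  have h := (key s hs).2
  have hz : ((s.card : ℝ) + t * (s.map fun a => a⁻¹).sum) / M - s.card = 0 := by
    have hNM : N + t * (s.map fun a => a⁻¹).sum = N * M := by rw [hM]; field_simp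
    rw [← hN, hNM, mul_div_assoc, div_self hMpos.ne', mul_one, sub_self]
  rw [hz, Real.exp_zero, mul_one] at h
  exact h

/-- Gurvits' univariate inequality: if all roots of `P`, of degree `k + 1 ≥ 2`, are negative reals
and `P t ≥ K t` for `t > 0`, then `P' 0 ≥ (k / (k + 1)) ^ k K`. -/
theorem Polynomial.le_coeff_one_of_roots_neg {P : Polynomial ℝ} {k : ℕ} (hk : 0 < k)
    (hdeg : P.natDegree = k + 1)
    (hroot : ∀ t : ℂ, (P.map (algebraMap ℝ ℂ)).eval t = 0 → t.re < 0 ∧ t.im = 0)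
    {K : ℝ} (hK : 0 < K) (hP : ∀ t : ℝ, 0 < t → K * t ≤ P.eval t) :
    ((k : ℝ) / (k + 1)) ^ k * K ≤ P.coeff 1 := by
  obtain ⟨s, hs, hcard, hPs⟩ := Polynomial.exists_eq_prod_X_add_C hroot
  rw [hdeg] at hcard
  set c := P.leadingCoeff
  have heval : ∀ t, P.eval t = c * (s.map fun a => t + a).prod := by
    intro t
    rw [hPs, Polynomial.eval_mul, Polynomial.eval_C, Polynomial.eval_multiset_prod,
      Multiset.map_map]
    simp
  have hprod : ∀ t : ℝ, 0 ≤ t → 0 < (s.map fun a => t + a).prod := by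
    intro t ht
    apply Multiset.prod_pos
    intro x hx
    obtain ⟨a, ha, rfl⟩ := Multiset.mem_map.1 hx
    have := hs a ha
    positivity
  have hc : 0 < c := by
    have h1 := hP 1 one_pos
    rw [heval] at h1
    exact pos_of_mul_pos_left (lt_of_lt_of_le (by linarith) h1) (hprod 1 zero_le_one).le
  have hb : 0 < s.prod := by simpa using hprod 0 le_rfl
  have hcoeff : P.coeff 1 = c * (s.prod * (s.map fun a => a⁻¹).sum) := by
    rw [hPs, Polynomial.coeff_C_mul, Polynomial.coeff_one_prod_X_add_C s hs]
  set S := (s.map fun a => a⁻¹).sum with hSdef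
  have hS : 0 < S := by
    obtain ⟨a, ha⟩ := Multiset.card_pos_iff_exists_mem.1 (show 0 < s.card by omega)
    refine lt_of_lt_of_le (inv_pos.2 (hs a ha)) ?_
    apply Multiset.single_le_sum (fun x hx => ?_) _ (Multiset.mem_map_of_mem _ ha)
    obtain ⟨b, hb, rfl⟩ := Multiset.mem_map.1 hx
    exact (inv_pos.2 (hs b hb)).le
  have hk' : (0 : ℝ) < k := by exact_mod_cast hk
  -- the minimiser of `(1 + t S / (k + 1)) ^ (k + 1) / t`
  set t : ℝ := (k + 1) / (S * k) with ht
  have htpos : 0 < t := by positivity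
  have h1 := hP t htpos
  rw [heval] at h1
  have h2 := Multiset.prod_add_le_prod_mul_pow s hs (by omega) htpos
  rw [hcard] at h2
  have h3 : K * t ≤ c * (s.prod * (((k : ℝ) + 1) / k) ^ (k + 1)) := by
    refine h1.trans (mul_le_mul_of_nonneg_left (h2.trans_eq ?_) hc.le)
    congr 2
    rw [← hSdef, ht]
    push_cast
    field_simp
  rw [hcoeff]
  have h4 : K ≤ c * s.prod * S * (((k : ℝ) + 1) / k) ^ k := by
    have : c * (s.prod * (((k : ℝ) + 1) / k) ^ (k + 1)) =
        (c * s.prod * S * (((k : ℝ) + 1) / k) ^ k) * t := by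
      rw [ht, pow_succ]; field_simp
    rw [this] at h3
    exact le_of_mul_le_mul_right h3 htpos
  calc ((k : ℝ) / (k + 1)) ^ k * K
      ≤ ((k : ℝ) / (k + 1)) ^ k * (c * s.prod * S * (((k : ℝ) + 1) / k) ^ k) := by gcongr
    _ = (((k : ℝ) / (k + 1)) * (((k : ℝ) + 1) / k)) ^ k * (c * s.prod * S) := by
        rw [mul_pow]; ring
    _ = c * (s.prod * S) := by
        rw [show ((k : ℝ) / (k + 1)) * (((k : ℝ) + 1) / k) = 1 by field_simp]; ring

/-! ### Stable polynomials and Gurvits' capacity inequality -/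

/-- A real polynomial is *strictly stable* if it has no zero in the closed right half-space other
than those all of whose coordinates are purely imaginary. Compared with stability (no zeros in the
open half-space), this variant survives differentiation without a limiting argument. -/
def MvPolynomial.IsStrictlyStable {n : ℕ} (p : MvPolynomial (Fin n) ℝ) : Prop :=
  ∀ z : Fin n → ℂ, (∀ i, 0 ≤ (z i).re) → (∃ i, 0 < (z i).re) → MvPolynomial.aeval z p ≠ 0

namespace MvPolynomial

theorem aeval_fin_cons {R A : Type*} [CommSemiring R] [CommSemiring A] [Algebra R A] {n : ℕ}
    (t : A) (z : Fin n → A) (p : MvPolynomial (Fin (n + 1)) R) :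
    aeval (Fin.cons t z : Fin (n + 1) → A) p =
      ((finSuccEquiv R n p).map (aeval z : MvPolynomial (Fin n) R →ₐ[R] A).toRingHom).eval t := by
  induction p using MvPolynomial.induction_on with
  | C a => simp [finSuccEquiv_apply]
  | add p q hp hq => simp only [map_add, Polynomial.map_add, Polynomial.eval_add, hp, hq]
  | mul_X p i hp =>
    rw [map_mul, map_mul, Polynomial.map_mul, Polynomial.eval_mul, hp]
    congr 1
    refine Fin.cases ?_ (fun j => ?_) i
    · simp [finSuccEquiv_X_zero]
    · simp [finSuccEquiv_X_succ]

theorem IsHomogeneous.aeval_smul {R A σ : Type*} [CommSemiring R] [CommSemiring A] [Algebra R A]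
    {p : MvPolynomial σ R} {n : ℕ} (hp : p.IsHomogeneous n) (c : A) (z : σ → A) :
    MvPolynomial.aeval (fun i => c * z i) p = c ^ n * MvPolynomial.aeval z p := by
  rw [MvPolynomial.aeval_def, MvPolynomial.aeval_def, MvPolynomial.eval₂_eq,
    MvPolynomial.eval₂_eq, Finset.mul_sum]
  refine Finset.sum_congr rfl fun d hd => ?_
  have hdeg : ∑ i ∈ d.support, d i = n := by
    have := hp (mem_support_iff.1 hd)
    rwa [Finsupp.weight_apply, Finsupp.sum, Finset.sum_congr rfl fun i _ => by
      rw [Pi.one_apply, smul_eq_mul, mul_one]] at this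
  rw [← hdeg, ← Finset.prod_pow_eq_pow_sum]
  simp only [mul_pow, Finset.prod_mul_distrib]
  ring

/-- The complex univariate polynomial `t ↦ p (t, z)` for homogeneous strictly stable `p` has full
degree. -/
theorem IsStrictlyStable.natDegree_map_finSuccEquiv {n N : ℕ} {p : MvPolynomial (Fin (n + 1)) ℝ}
    (hp : p.IsStrictlyStable) (hhom : p.IsHomogeneous N) (z : Fin n → ℂ) :
    ((finSuccEquiv ℝ n p).map
      (aeval z : MvPolynomial (Fin n) ℝ →ₐ[ℝ] ℂ).toRingHom).natDegree = N := by
  have hcoeff : ∀ w : Fin n → ℂ, ((finSuccEquiv ℝ n p).map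
      (aeval w : MvPolynomial (Fin n) ℝ →ₐ[ℝ] ℂ).toRingHom).coeff N =
      algebraMap ℝ ℂ (coeff 0 ((finSuccEquiv ℝ n p).coeff N)) := by
    intro w
    rw [Polynomial.coeff_map]
    have h0 := hhom.finSuccEquiv_coeff_isHomogeneous N 0 (by simp)
    rw [← totalDegree_zero_iff_isHomogeneous, totalDegree_eq_zero_iff_eq_C] at h0
    rw [h0]
    simp
  have hle : ∀ w : Fin n → ℂ, ((finSuccEquiv ℝ n p).map
      (aeval w : MvPolynomial (Fin n) ℝ →ₐ[ℝ] ℂ).toRingHom).natDegree ≤ N := by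
    intro w
    refine Polynomial.natDegree_map_le.trans ?_
    rw [natDegree_finSuccEquiv]
    exact (degreeOf_le_totalDegree p 0).trans hhom.totalDegree_le
  refine le_antisymm (hle z) (Polynomial.le_natDegree_of_ne_zero ?_)
  rw [hcoeff z, ← hcoeff 0]
  intro h
  -- homogeneity: the leading coefficient is the value of `p` at `(1, 0, …, 0)`
  have h1 := hp (Fin.cons 1 0) (fun i => by refine Fin.cases ?_ (fun j => ?_) i <;> simp)
    ⟨0, by simp⟩
  apply h1
  rw [aeval_fin_cons, Polynomial.eval_eq_sum_range' (Nat.lt_succ_of_le (hle 0))]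
  refine Finset.sum_eq_zero fun i hi => ?_
  rcases eq_or_ne i N with rfl | hne
  · rw [h, zero_mul]
  · have hiN : i ≤ N := by simpa [Nat.lt_succ_iff] using hi
    have hh := hhom.finSuccEquiv_coeff_isHomogeneous i (N - i) (by omega)
    have := hh.aeval_smul (0 : ℂ) 0
    rw [zero_pow (by omega), zero_mul] at this
    rw [Polynomial.coeff_map]
    have h2 : (aeval (0 : Fin n → ℂ)) ((finSuccEquiv ℝ n p).coeff i) = 0 := by
      rw [← this]; congr 1; simp; rfl
    simp [h2]

/-- Differentiating with respect to one variable and setting it to zero preserves strict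
stability. -/
theorem IsStrictlyStable.finSuccEquiv_coeff_one {n N : ℕ} {p : MvPolynomial (Fin (n + 1)) ℝ}
    (hp : p.IsStrictlyStable) (hhom : p.IsHomogeneous N) (hN : 0 < N) :
    ((finSuccEquiv ℝ n p).coeff 1).IsStrictlyStable := by
  intro z hz hz'
  have hcoeff : aeval z ((finSuccEquiv ℝ n p).coeff 1) = ((finSuccEquiv ℝ n p).map
      (aeval z : MvPolynomial (Fin n) ℝ →ₐ[ℝ] ℂ).toRingHom).coeff 1 := by
    rw [Polynomial.coeff_map]; rfl
  rw [hcoeff]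
  apply Polynomial.coeff_one_ne_zero_of_roots_re_neg
  · rw [hp.natDegree_map_finSuccEquiv hhom]; exact hN
  · intro t ht
    rw [← aeval_fin_cons]
    obtain ⟨i, hi⟩ := hz'
    exact hp _ (fun i => by refine Fin.cases ?_ (fun j => ?_) i <;> simp [ht, hz])
      ⟨i.succ, by simpa using hi⟩

/-- For homogeneous strictly stable `p` and positive real `x`, the polynomial `t ↦ p (t, x)` has
only negative real roots: any other pair `(t, x)` is rotated into the right half-space by the
factor `conj t + |t|`. -/
theorem IsStrictlyStable.root_neg {n N : ℕ} {p : MvPolynomial (Fin (n + 1)) ℝ}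
    (hp : p.IsStrictlyStable) (hhom : p.IsHomogeneous N) (hn : 0 < n) {x : Fin n → ℝ}
    (hx : ∀ i, 0 < x i) {t : ℂ}
    (ht : aeval (Fin.cons t (fun i => (x i : ℂ)) : Fin (n + 1) → ℂ) p = 0) :
    t.re < 0 ∧ t.im = 0 := by
  by_contra hcon
  have hne : t ≠ 0 := by
    rintro rfl
    exact hp _ (fun i => by refine Fin.cases ?_ (fun j => ?_) i <;> simp [(hx _).le])
      ⟨(⟨0, hn⟩ : Fin n).succ, by simpa only [Fin.cons_succ, Complex.ofReal_re] using hx _⟩ ht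
  have hnorm : 0 < ‖t‖ := norm_pos_iff.2 hne
  have hpos : 0 < ‖t‖ + t.re := by
    have h1 := Complex.abs_re_le_norm t
    have h2 : -‖t‖ ≤ t.re := (abs_le.1 h1).1
    rcases h2.lt_or_eq with h | h
    · linarith
    · exfalso
      apply hcon
      refine ⟨by linarith, ?_⟩
      have h3 := Complex.sq_norm t
      rw [Complex.normSq_apply] at h3
      have : t.im * t.im = 0 := by
        have h4 : ‖t‖ = -t.re := by linarith
        rw [h4] at h3
        linarith
      simpa using this
  set l : ℂ := (starRingEnd ℂ) t + (‖t‖ : ℂ) with hl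
  have hlre : 0 < l.re := by
    rw [hl]; simp; linarith
  have hlt : 0 < (l * t).re := by
    have h3 := Complex.sq_norm t
    rw [Complex.normSq_apply] at h3
    have : (l * t).re = ‖t‖ * (‖t‖ + t.re) := by
      rw [hl]; simp only [Complex.mul_re, Complex.add_re, Complex.add_im, Complex.conj_re,
        Complex.conj_im, Complex.ofReal_re, Complex.ofReal_im]
      nlinarith
    rw [this]; positivity
  have h := hhom.aeval_smul l (Fin.cons t (fun i => (x i : ℂ)) : Fin (n + 1) → ℂ)
  rw [ht, mul_zero] at h
  refine hp _ (fun i => ?_) ⟨0, ?_⟩ h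
  · refine Fin.cases ?_ (fun j => ?_) i
    · simpa using hlt.le
    · simp only [Fin.cons_succ, Complex.re_mul_ofReal]
      exact (mul_pos hlre (hx j)).le
  · simpa using hlt

/-- Gurvits' capacity inequality: if a homogeneous strictly stable polynomial of degree `n` in `n`
variables dominates `C x₁ ⋯ xₙ` on the positive orthant, then its coefficient at `x₁ ⋯ xₙ` is at
least `C n! / nⁿ`. -/
theorem IsStrictlyStable.le_coeff_one {n : ℕ} (hn : 0 < n) {p : MvPolynomial (Fin n) ℝ}
    (hp : p.IsStrictlyStable) (hhom : p.IsHomogeneous n) {C : ℝ} (hC : 0 < C)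
    (hcap : ∀ x : Fin n → ℝ, (∀ i, 0 < x i) → C * ∏ i, x i ≤ eval x p) :
    C * ((n ! : ℝ) / (n : ℝ) ^ n) ≤ coeff (Finsupp.equivFunOnFinite.symm fun _ => 1) p := by
  induction n, hn using Nat.le_induction generalizing C with
  -- the induction starts at one variable, because strict stability is vacuous without variables
  | base =>
    have h := hcap (fun _ => 1) (fun _ => one_pos)
    have hcoeff : eval (fun _ => (1 : ℝ)) p =
        coeff (Finsupp.equivFunOnFinite.symm fun _ => 1) p := by
      rw [eval_eq]
      simp only [one_pow, Finset.prod_const_one, mul_one]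
      rw [Finset.sum_eq_single (Finsupp.equivFunOnFinite.symm fun _ => 1)]
      · intro d hd hne
        exfalso
        apply hne
        have := hhom (mem_support_iff.1 hd)
        refine Finsupp.ext fun i => ?_
        rw [Subsingleton.elim i 0]
        simpa [Finsupp.weight_apply, Finsupp.sum_fintype] using this
      · intro h; simpa using h
    rw [hcoeff] at h
    simpa using h
  | succ n hn ih =>
    have hn0 : 0 < n := hn
    have hcons : Finsupp.cons 1 (Finsupp.equivFunOnFinite.symm fun _ : Fin n => 1) =
        (Finsupp.equivFunOnFinite.symm fun _ : Fin (n + 1) => 1) := by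
      ext i
      refine Fin.cases ?_ (fun j => ?_) i <;> simp
    rw [← hcons, ← finSuccEquiv_coeff_coeff]
    have hq := hp.finSuccEquiv_coeff_one hhom n.succ_pos
    have hqhom := hhom.finSuccEquiv_coeff_isHomogeneous 1 n (by omega)
    have hn' : (0 : ℝ) < n := by exact_mod_cast hn0
    refine le_trans (le_of_eq ?_) (ih hq hqhom
      (C := ((n : ℝ) / (n + 1)) ^ n * C) (by positivity) fun x hx => ?_)
    · rw [Nat.factorial_succ]
      push_cast
      rw [div_pow, pow_succ]
      field_simp
    · set P : Polynomial ℝ := (finSuccEquiv ℝ n p).map (eval x) with hPdef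
      have hmap : P.map (algebraMap ℝ ℂ) = (finSuccEquiv ℝ n p).map
          (aeval (fun i => (x i : ℂ)) : MvPolynomial (Fin n) ℝ →ₐ[ℝ] ℂ).toRingHom := by
        rw [hPdef, Polynomial.map_map]
        congr 1
        apply MvPolynomial.ringHom_ext <;> simp
      have h := Polynomial.le_coeff_one_of_roots_neg (P := P) hn0
        (by rw [← Polynomial.natDegree_map (algebraMap ℝ ℂ), hmap,
              hp.natDegree_map_finSuccEquiv hhom])
        (fun t ht => hp.root_neg hhom hn0 hx (by rw [aeval_fin_cons, ← hmap, ht]))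
        (K := C * ∏ i, x i) (mul_pos hC (Finset.prod_pos fun i _ => hx i))
        (fun t ht => by
          have := hcap (Fin.cons t x) (fun i => by
            refine Fin.cases ?_ (fun j => ?_) i <;> simp [ht, hx])
          rw [eval_eq_eval_mv_eval', Fin.prod_univ_succ] at this
          simp only [Fin.cons_zero, Fin.cons_succ] at this
          rw [hPdef]
          linarith)
      rw [hPdef, Polynomial.coeff_map] at h
      rw [mul_assoc]
      exact h

end MvPolynomial

/-! ### The van der Waerden lower bound for permanents -/

namespace Matrix

open MvPolynomial in
/-- The permanent is the coefficient at `x₁ ⋯ xₙ` of the product of the linear forms given by the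
rows. -/
theorem coeff_prod_linearForms {n : ℕ} (A : Matrix (Fin n) (Fin n) ℝ) :
    coeff (Finsupp.equivFunOnFinite.symm fun _ => 1)
      (∏ i, ∑ j, (C (A i j) * X j : MvPolynomial (Fin n) ℝ)) = Aᵀ.permanent := by
  classical
  rw [Finset.prod_univ_sum, coeff_sum, Fintype.piFinset_univ]
  have hterm : ∀ f : Fin n → Fin n, coeff (Finsupp.equivFunOnFinite.symm fun _ => 1)
      (∏ i, (C (A i (f i)) * X (f i) : MvPolynomial (Fin n) ℝ)) =
      if Function.Bijective f then ∏ i, A i (f i) else 0 := by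
    intro f
    have hX : ∏ i, (X (f i) : MvPolynomial (Fin n) ℝ) =
        monomial (∑ i, Finsupp.single (f i) 1) 1 := by
      rw [monomial_sum_one]; rfl
    rw [Finset.prod_mul_distrib, hX, ← map_prod, coeff_C_mul, coeff_monomial, mul_ite, mul_one,
      mul_zero]
    congr 1
    rw [eq_iff_iff]
    constructor
    · intro h
      apply (Finite.surjective_iff_bijective).1
      intro j
      by_contra hj
      push Not at hj
      have := DFunLike.congr_fun h j
      simp [Finsupp.finsetSum_apply, hj] at this
    · intro h
      refine Finsupp.ext fun j => ?_
      obtain ⟨i, rfl⟩ := h.2 j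
      simp [Finsupp.finsetSum_apply, Finsupp.single_apply, h.1.eq_iff]
  simp only [hterm]
  rw [← Finset.sum_filter, permanent]
  symm
  refine Finset.sum_bij (fun (σ : Equiv.Perm (Fin n)) _ => (σ : Fin n → Fin n)) ?_ ?_ ?_ ?_
  · intro σ _; exact Finset.mem_filter.2 ⟨Finset.mem_univ _, σ.bijective⟩
  · intro σ _ τ _ h; exact Equiv.coe_fn_injective h
  · intro f hf
    exact ⟨Equiv.ofBijective f (Finset.mem_filter.1 hf).2, Finset.mem_univ _, rfl⟩
  · intro σ _; rfl

/-- The van der Waerden bound for matrices with positive entries. -/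
theorem le_permanent_of_pos {n : ℕ} (hn : 0 < n) (A : Matrix (Fin n) (Fin n) ℝ)
    (hA : ∀ i j, 0 < A i j) {c : ℝ} (hrow : ∀ i, ∑ j, A i j = c) (hcol : ∀ j, ∑ i, A i j = c) :
    c ^ n * ((n ! : ℝ) / (n : ℝ) ^ n) ≤ A.permanent := by
  have hc : 0 < c := by
    rw [← hrow ⟨0, hn⟩]
    exact Finset.sum_pos (fun j _ => hA _ j) ⟨⟨0, hn⟩, Finset.mem_univ _⟩
  rw [← permanent_transpose, ← coeff_prod_linearForms]
  apply MvPolynomial.IsStrictlyStable.le_coeff_one hn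
  · intro z hz ⟨k, hk⟩
    rw [map_prod]
    refine Finset.prod_ne_zero_iff.2 fun i _ h => ?_
    have hre : 0 < ∑ j, A i j * (z j).re :=
      Finset.sum_pos' (fun j _ => mul_nonneg (hA i j).le (hz j))
        ⟨k, Finset.mem_univ _, mul_pos (hA i k) hk⟩
    have := congrArg Complex.re h
    simp only [map_sum, map_mul, MvPolynomial.aeval_C, MvPolynomial.aeval_X, Complex.re_sum,
      Complex.coe_algebraMap, Complex.re_ofReal_mul, Complex.zero_re] at this
    linarith
  · have := MvPolynomial.IsHomogeneous.prod Finset.univ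
      (fun i => ∑ j, (MvPolynomial.C (A i j) * MvPolynomial.X j : MvPolynomial (Fin n) ℝ))
      (fun _ => 1) (fun i _ => MvPolynomial.IsHomogeneous.sum _ _ _ fun j _ => by
        simpa using (MvPolynomial.isHomogeneous_C (Fin n) (A i j)).mul
          (MvPolynomial.isHomogeneous_X ℝ j))
    simpa using this
  · positivity
  · intro x hx
    have hform : ∀ i, c * ∏ j, x j ^ (A i j / c) ≤ ∑ j, A i j * x j := by
      intro i
      have := Real.geom_mean_le_arith_mean_weighted Finset.univ (fun j => A i j / c) x
        (fun j _ => (div_pos (hA i j) hc).le) (by rw [← Finset.sum_div, hrow, div_self hc.ne'])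
        (fun j _ => (hx j).le)
      calc c * ∏ j, x j ^ (A i j / c) ≤ c * ∑ j, A i j / c * x j := by gcongr
        _ = _ := by
          rw [Finset.mul_sum]
          refine Finset.sum_congr rfl fun j _ => ?_
          field_simp
    calc c ^ n * ∏ j, x j = ∏ i, (c * ∏ j, x j ^ (A i j / c)) := by
          rw [Finset.prod_mul_distrib, Finset.prod_const, Finset.card_univ, Fintype.card_fin,
            Finset.prod_comm]
          congr 1
          refine Finset.prod_congr rfl fun j _ => ?_
          rw [← Real.rpow_sum_of_pos (hx j), ← Finset.sum_div, hcol, div_self hc.ne',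
            Real.rpow_one]
      _ ≤ ∏ i, ∑ j, A i j * x j := by
          refine Finset.prod_le_prod (fun i _ => ?_) fun i _ => hform i
          exact mul_nonneg hc.le (Finset.prod_nonneg fun j _ => Real.rpow_nonneg (hx j).le _)
      _ = _ := by simp [map_prod, map_sum]

/-- The van der Waerden bound (theorem of Falikman and Egorychev): the permanent of a nonnegative
`n × n` matrix with all row and column sums `c` is at least `cⁿ n! / nⁿ`. -/
theorem le_permanent_of_nonneg {ι : Type*} [Fintype ι] [DecidableEq ι] [Nonempty ι]
    (A : Matrix ι ι ℝ) (hA : ∀ i j, 0 ≤ A i j) {c : ℝ} (hrow : ∀ i, ∑ j, A i j = c)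
    (hcol : ∀ j, ∑ i, A i j = c) :
    c ^ Fintype.card ι * (((Fintype.card ι)! : ℝ) / (Fintype.card ι : ℝ) ^ Fintype.card ι) ≤
      A.permanent := by
  set n := Fintype.card ι with hn
  have hnpos : 0 < n := Fintype.card_pos
  let e : ι ≃ Fin n := Fintype.equivFin ι
  -- a positive perturbation of the matrix, indexed by `Fin n`
  have hpert : ∀ ε : ℝ, 0 < ε → (c + n * ε) ^ n * ((n ! : ℝ) / (n : ℝ) ^ n) ≤
      ∑ σ : Equiv.Perm ι, ∏ i, (A (σ i) i + ε) := by
    intro ε hε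
    have h := le_permanent_of_pos hnpos (fun i j => A (e.symm i) (e.symm j) + ε)
      (fun i j => add_pos_of_nonneg_of_pos (hA _ _) hε) (c := c + n * ε)
      (fun i => by
        rw [Finset.sum_add_distrib, e.symm.sum_comp (fun j => A (e.symm i) j), hrow]; simp)
      (fun j => by
        rw [Finset.sum_add_distrib, e.symm.sum_comp (fun i => A i (e.symm j)), hcol]; simp)
    refine h.trans_eq ?_
    change ∑ σ : Equiv.Perm (Fin n), ∏ i, (A (e.symm (σ i)) (e.symm i) + ε) = _
    rw [← Equiv.sum_comp e.permCongr]
    refine Finset.sum_congr rfl fun σ _ => ?_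
    rw [← e.prod_comp]
    simp [Equiv.permCongr_apply]
  have hlim1 : Filter.Tendsto (fun ε : ℝ => (c + n * ε) ^ n * ((n ! : ℝ) / (n : ℝ) ^ n))
      (nhdsWithin 0 (Set.Ioi 0)) (nhds ((c + n * 0) ^ n * ((n ! : ℝ) / (n : ℝ) ^ n))) :=
    (Continuous.tendsto (by fun_prop) 0).mono_left nhdsWithin_le_nhds
  have hlim2 : Filter.Tendsto (fun ε : ℝ => ∑ σ : Equiv.Perm ι, ∏ i, (A (σ i) i + ε))
      (nhdsWithin 0 (Set.Ioi 0)) (nhds (∑ σ : Equiv.Perm ι, ∏ i, (A (σ i) i + 0))) :=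
    (Continuous.tendsto (f := fun ε : ℝ => ∑ σ : Equiv.Perm ι, ∏ i, (A (σ i) i + ε))
      (by fun_prop) 0).mono_left nhdsWithin_le_nhds
  have h := le_of_tendsto_of_tendsto hlim1 hlim2
    (Filter.eventually_of_mem self_mem_nhdsWithin fun ε hε => hpert ε hε)
  simpa [permanent] using h

end Matrix

/-! ### Bregman's upper bound for permanents of binary matrices -/

/-- The number of bijections compatible with a relation, that is, the permanent of the binary
matrix of the relation. -/
noncomputable def permCount {ι κ : Type*} (R : ι → κ → Prop) : ℕ :=
  Nat.card {e : ι ≃ κ // ∀ i, R i (e i)}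

/-- The logarithm of `(r!) ^ (1 / r)`. Its value at `r = 0` is `0`. -/
noncomputable def logFactorialRoot (r : ℕ) : ℝ := Real.log (r ! : ℝ) / r

theorem nat_mul_logFactorialRoot (r : ℕ) : r * logFactorialRoot r = Real.log (r ! : ℝ) := by
  rcases Nat.eq_zero_or_pos r with rfl | hr
  · simp
  · have : (r : ℝ) ≠ 0 := by positivity
    rw [logFactorialRoot]; field_simp

theorem log_add_mul_logFactorialRoot {r : ℕ} (hr : 0 < r) :
    Real.log r + ((r - 1 : ℕ) : ℝ) * logFactorialRoot (r - 1) = r * logFactorialRoot r := by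
  obtain ⟨k, rfl⟩ : ∃ k, r = k + 1 := ⟨r - 1, by omega⟩
  rw [Nat.add_sub_cancel, nat_mul_logFactorialRoot, nat_mul_logFactorialRoot, Nat.factorial_succ,
    Nat.cast_mul, Real.log_mul (by positivity) (by positivity)]

theorem monotone_logFactorialRoot : Monotone logFactorialRoot := by
  refine monotone_nat_of_le_succ fun k => ?_
  rcases Nat.eq_zero_or_pos k with rfl | hk
  · simp [logFactorialRoot]
  · have hk' : (0 : ℝ) < k := by exact_mod_cast hk
    rw [logFactorialRoot, logFactorialRoot, div_le_div_iff₀ hk' (by positivity),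
      Nat.factorial_succ, Nat.cast_mul, Real.log_mul (by positivity) (by positivity)]
    have h1 : Real.log (k ! : ℝ) ≤ k * Real.log ((k + 1 : ℕ) : ℝ) := by
      rw [← Real.log_pow]
      apply Real.log_le_log (by positivity)
      exact_mod_cast (Nat.factorial_le_pow k).trans (Nat.pow_le_pow_left (Nat.le_succ k) k)
    push_cast at h1 ⊢
    nlinarith

/-- Bijections with one prescribed value correspond to bijections between the complements. -/
theorem card_equiv_apply_eq {ι κ : Type*} (R : ι → κ → Prop) {i₀ : ι} {k₀ : κ} (h : R i₀ k₀) :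
    Nat.card {e : ι ≃ κ // (∀ i, R i (e i)) ∧ e i₀ = k₀} =
      permCount fun (i : {i // i ≠ i₀}) (k : {k // k ≠ k₀}) => R i k := by
  classical
  refine Nat.card_congr ⟨fun e => ⟨e.1.subtypeEquiv fun i => ?_, fun i => e.2.1 i⟩,
    fun e => ⟨(Equiv.optionSubtypeNe i₀).symm.trans
      ((Equiv.optionCongr e.1).trans (Equiv.optionSubtypeNe k₀)), fun i => ?_, by simp⟩, ?_, ?_⟩
  · exact not_congr ⟨fun hi => hi ▸ e.2.2, fun hi => e.1.injective (hi.trans e.2.2.symm)⟩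
  · by_cases hi : i = i₀
    · subst hi; simpa using h
    · simpa [Equiv.optionSubtypeNe_symm_of_ne hi] using e.2 ⟨i, hi⟩
  · rintro ⟨e, he, rfl⟩
    apply Subtype.ext
    ext i
    by_cases hi : i = i₀
    · subst hi; simp
    · simp [Equiv.optionSubtypeNe_symm_of_ne hi]
  · rintro ⟨e, he⟩
    apply Subtype.ext
    ext ⟨i, hi⟩
    simp [Equiv.optionSubtypeNe_symm_of_ne hi]

/-- Convexity of `x log x`, applied to a partition of `∑ t` into `s.card` parts. -/
theorem sum_mul_log_sum_le {κ : Type*} (s : Finset κ) (t : κ → ℝ) (ht : ∀ k ∈ s, 0 ≤ t k)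
    (hpos : 0 < ∑ k ∈ s, t k) :
    (∑ k ∈ s, t k) * Real.log (∑ k ∈ s, t k) ≤
      (∑ k ∈ s, t k) * Real.log s.card + ∑ k ∈ s, t k * Real.log (t k) := by
  have hs : s.Nonempty := by
    rw [Finset.nonempty_iff_ne_empty]; rintro rfl; simp at hpos
  have hc : (0 : ℝ) < s.card := by exact_mod_cast hs.card_pos
  have h := Real.convexOn_mul_log.map_sum_le (t := s) (w := fun _ => (s.card : ℝ)⁻¹) (p := t)
    (fun _ _ => by positivity) (by simp [hc.ne']) (fun k hk => ht k hk)
  simp only [smul_eq_mul, ← Finset.mul_sum] at h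
  rw [Real.log_mul (by positivity) hpos.ne', Real.log_inv, mul_assoc] at h
  have := le_of_mul_le_mul_left h (by positivity)
  linarith

open Classical in
/-- The combinatorial step of Bregman's theorem. For a compatible bijection `σ`, the bounds for the
complements of the pairs `(i, σ i)`, summed over all rows `i`, reassemble to `card ι` times the
bound for the whole relation: row `j`, with `r` entries, loses an entry for exactly `r - 1` of the rows
`i ≠ j`. -/
theorem sum_logFactorialRoot_erase {ι κ : Type*} [Fintype ι] [Fintype κ] (K : ι → Finset κ)
    (σ : ι ≃ κ) (hσ : ∀ i, σ i ∈ K i) :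
    ∑ i, (Real.log (K i).card +
        ∑ j ∈ Finset.univ.erase i, logFactorialRoot ((K j).erase (σ i)).card) =
      Fintype.card ι * ∑ j, logFactorialRoot (K j).card := by
  have hswap : ∑ i, ∑ j ∈ Finset.univ.erase i, logFactorialRoot ((K j).erase (σ i)).card =
      ∑ j, ∑ i ∈ Finset.univ.erase j, logFactorialRoot ((K j).erase (σ i)).card :=
    Finset.sum_comm' (by intro i j; simp [eq_comm])
  rw [Finset.sum_add_distrib, hswap, ← Finset.sum_add_distrib, Finset.mul_sum]
  refine Finset.sum_congr rfl fun j _ => ?_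
  have hr : 0 < (K j).card := Finset.card_pos.2 ⟨_, hσ j⟩
  have hreindex : ∑ i ∈ Finset.univ.erase j, logFactorialRoot ((K j).erase (σ i)).card =
      ∑ k ∈ Finset.univ.erase (σ j), logFactorialRoot ((K j).erase k).card := by
    refine Finset.sum_bij (fun i _ => σ i) ?_ ?_ ?_ ?_
    · intro i hi; simpa using hi
    · intro a _ b _ h; exact σ.injective h
    · intro k hk; exact ⟨σ.symm k, by simpa [Equiv.symm_apply_eq] using hk, by simp⟩
    · intro i _; rfl
  have hsplit : Finset.univ.erase (σ j) = (K j).erase (σ j) ∪ (K j)ᶜ := by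
    ext k
    by_cases hk : k = σ j
    · subst hk; simp [hσ j]
    · simpa [hk] using Classical.em _
  have hdisj : Disjoint ((K j).erase (σ j)) (K j)ᶜ :=
    Finset.disjoint_left.2 fun k hk hk' =>
      (Finset.mem_compl.1 hk') (Finset.mem_of_mem_erase hk)
  rw [hreindex, hsplit, Finset.sum_union hdisj,
    Finset.sum_congr rfl fun k hk => by rw [Finset.card_erase_of_mem (Finset.mem_of_mem_erase hk)],
    Finset.sum_congr (s₁ := (K j)ᶜ) rfl fun k hk => by
      rw [Finset.erase_eq_of_notMem (Finset.mem_compl.1 hk)],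
    Finset.sum_const, Finset.sum_const, nsmul_eq_mul, nsmul_eq_mul,
    Finset.card_erase_of_mem (hσ j), ← add_assoc, log_add_mul_logFactorialRoot hr,
    Finset.card_compl, Nat.cast_sub (Finset.card_le_univ _), Fintype.card_congr σ]
  ring

open Classical in
/-- Bregman's theorem in logarithmic form, by Schrijver's induction: for each row, convexity of
`x log x` compares the count with the counts in the complements of the entries of that row. -/
theorem log_permCount_le {ι κ : Type*} [Fintype ι] [Fintype κ] (R : ι → κ → Prop)
    (hpos : 0 < permCount R) :
    Real.log (permCount R) ≤
      ∑ i, logFactorialRoot (Finset.univ.filter fun k => R i k).card := by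
  induction hn : Fintype.card ι generalizing ι κ with
  | zero =>
    have : IsEmpty ι := Fintype.card_eq_zero_iff.1 hn
    have hle : permCount R ≤ 1 := by
      have : Subsingleton {e : ι ≃ κ // ∀ i, R i (e i)} :=
        ⟨fun a b => Subtype.ext (Equiv.ext fun i => isEmptyElim i)⟩
      exact Finite.card_le_one_iff_subsingleton.2 this
    have : permCount R = 1 := by omega
    simp [this]
  | succ n ih =>
    set S : Finset (ι ≃ κ) := Finset.univ.filter fun e => ∀ i, R i (e i) with hS
    set K : ι → Finset κ := fun i => Finset.univ.filter fun k => R i k with hK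
    have hSmem : ∀ σ ∈ S, ∀ i, σ i ∈ K i := by
      intro σ hσ i
      simpa [hK] using (Finset.mem_filter.1 hσ).2 i
    have hScard : permCount R = S.card := by
      rw [permCount, Nat.card_eq_fintype_card, Fintype.card_subtype]
    rw [hScard] at hpos ⊢
    set T : ι → κ → ℕ := fun i k => (S.filter fun σ => σ i = k).card with hT
    have hTsum : ∀ i, ∑ k ∈ K i, (T i k : ℝ) = S.card := by
      intro i
      rw [Finset.card_eq_sum_card_fiberwise (f := fun σ : ι ≃ κ => σ i) (t := K i)
        (fun σ hσ => hSmem σ hσ i)]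
      push_cast
      rfl
    have hTlog : ∀ i, ∑ k ∈ K i, (T i k : ℝ) * Real.log (T i k) =
        ∑ σ ∈ S, Real.log (T i (σ i)) := by
      intro i
      rw [← Finset.sum_fiberwise_of_maps_to (g := fun σ : ι ≃ κ => σ i) (t := K i)
        (fun σ hσ => hSmem σ hσ i)]
      refine Finset.sum_congr rfl fun k _ => ?_
      rw [Finset.sum_congr rfl fun σ hσ => by rw [(Finset.mem_filter.1 hσ).2], Finset.sum_const,
        nsmul_eq_mul]
    have hTle : ∀ σ ∈ S, ∀ i, Real.log (T i (σ i)) ≤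
        ∑ j ∈ Finset.univ.erase i, logFactorialRoot ((K j).erase (σ i)).card := by
      intro σ hσ i
      have hR : R i (σ i) := (Finset.mem_filter.1 hσ).2 i
      have hTeq : T i (σ i) =
          permCount fun (j : {j // j ≠ i}) (k : {k // k ≠ σ i}) => R j k := by
        rw [← card_equiv_apply_eq R hR, Nat.card_eq_fintype_card, Fintype.card_subtype, hT, hS]
        simp only [Finset.filter_filter]
      have hTpos : 0 < T i (σ i) :=
        Finset.card_pos.2 ⟨σ, Finset.mem_filter.2 ⟨hσ, rfl⟩⟩
      have h := ih (fun (j : {j // j ≠ i}) (k : {k // k ≠ σ i}) => R j k) (hTeq ▸ hTpos)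
        (by rw [Fintype.card_subtype_compl, hn]; simp)
      rw [← hTeq] at h
      refine h.trans_eq ?_
      rw [Finset.sum_subtype (Finset.univ.erase i) (p := fun j => j ≠ i) (by simp)]
      refine Finset.sum_congr rfl fun j _ => ?_
      congr 1
      rw [← Finset.card_map (Function.Embedding.subtype _)]
      congr 1
      ext k
      simp [hK, and_comm]
    have hSpos : (0 : ℝ) < S.card := by exact_mod_cast hpos
    have hrow : ∀ i, (S.card : ℝ) * Real.log S.card ≤
        ∑ σ ∈ S, (Real.log (K i).card + Real.log (T i (σ i))) := by
      intro i
      have h := sum_mul_log_sum_le (K i) (fun k => (T i k : ℝ)) (fun _ _ => by positivity)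
        (by rw [hTsum]; exact hSpos)
      rw [hTsum, hTlog] at h
      rw [Finset.sum_add_distrib, Finset.sum_const, nsmul_eq_mul]
      exact h
    have htotal : (Fintype.card ι : ℝ) * ((S.card : ℝ) * Real.log S.card) ≤
        (Fintype.card ι : ℝ) * ((S.card : ℝ) * ∑ j, logFactorialRoot (K j).card) := by
      calc (Fintype.card ι : ℝ) * ((S.card : ℝ) * Real.log S.card)
          = ∑ i : ι, (S.card : ℝ) * Real.log S.card := by simp
        _ ≤ ∑ i, ∑ σ ∈ S, (Real.log (K i).card + Real.log (T i (σ i))) :=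
            Finset.sum_le_sum fun i _ => hrow i
        _ = ∑ σ ∈ S, ∑ i, (Real.log (K i).card + Real.log (T i (σ i))) := Finset.sum_comm
        _ ≤ ∑ σ ∈ S, ∑ i, (Real.log (K i).card +
            ∑ j ∈ Finset.univ.erase i, logFactorialRoot ((K j).erase (σ i)).card) :=
            Finset.sum_le_sum fun σ hσ => Finset.sum_le_sum fun i _ => by
              linarith [hTle σ hσ i]
        _ = ∑ σ ∈ S, (Fintype.card ι : ℝ) * ∑ j, logFactorialRoot (K j).card :=
            Finset.sum_congr rfl fun σ hσ => sum_logFactorialRoot_erase K σ (hSmem σ hσ)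
        _ = _ := by rw [Finset.sum_const, nsmul_eq_mul]; ring
    have hcard : (0 : ℝ) < Fintype.card ι := by rw [hn]; positivity
    exact le_of_mul_le_mul_left (le_of_mul_le_mul_left htotal hcard) hSpos

/-- Bregman's theorem with a uniform bound `r` on the row sums. -/
theorem permCount_le_rpow {ι κ : Type*} [Fintype ι] [Fintype κ] (R : ι → κ → Prop)
    [∀ i, DecidablePred (R i)] {r : ℕ}
    (hr : ∀ i, (Finset.univ.filter fun k => R i k).card ≤ r) :
    (permCount R : ℝ) ≤ (r ! : ℝ) ^ ((Fintype.card ι : ℝ) / r) := by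
  rcases Nat.eq_zero_or_pos (permCount R) with h0 | hpos
  · rw [h0, Nat.cast_zero]; positivity
  · rw [← Real.log_le_log_iff (by exact_mod_cast hpos) (by positivity),
      Real.log_rpow (by positivity)]
    calc Real.log (permCount R) ≤ _ := log_permCount_le R hpos
      _ ≤ ∑ _i : ι, logFactorialRoot r :=
          Finset.sum_le_sum fun i _ =>
            monotone_logFactorialRoot ((hr i).trans_eq' (by congr))
      _ = _ := by
          rw [Finset.sum_const, Finset.card_univ, nsmul_eq_mul, logFactorialRoot]; ring

/-! ### Counting arrangements through permutations -/

theorem sum_comp_eq_mul_sum {α ι M : Type*} [Fintype α] [Fintype ι] [DecidableEq ι]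
    [CommSemiring M] {g : α → ι}
    {r : ℕ} (hg : ∀ i, (Finset.univ.filter fun a => g a = i).card = r) (F : ι → M) :
    ∑ a, F (g a) = r * ∑ i, F i := by
  rw [← Finset.sum_fiberwise (s := Finset.univ) (g := g), Finset.mul_sum]
  refine Finset.sum_congr rfl fun i _ => ?_
  rw [Finset.sum_congr rfl fun a ha => by rw [(Finset.mem_filter.1 ha).2], Finset.sum_const, hg,
    nsmul_eq_mul]

open Classical in
/-- Each arrangement `f` of the multiset of values of `g` is `g ∘ σ` for exactly
`(r!) ^ card ι` permutations `σ`. -/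
theorem permCount_eq_mul_card {α ι : Type*} [Fintype α] [Fintype ι] [DecidableEq ι]
    {g : α → ι} {r : ℕ} (hg : ∀ i, (Finset.univ.filter fun a => g a = i).card = r)
    (Q : ι → ι → Prop) :
    permCount (fun a b : α => Q (g b) (g a)) = (r !) ^ Fintype.card ι *
      (Finset.univ.filter fun f : α → ι =>
        (∀ i, (Finset.univ.filter fun a => f a = i).card = r) ∧ ∀ a, Q (f a) (g a)).card := by
  rw [permCount, Nat.card_eq_fintype_card, Fintype.card_subtype, mul_comm,
    Finset.card_eq_sum_card_fiberwise (f := fun σ : Equiv.Perm α => g ∘ σ)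
      (t := Finset.univ.filter fun f : α → ι =>
        (∀ i, (Finset.univ.filter fun a => f a = i).card = r) ∧ ∀ a, Q (f a) (g a))]
  · refine Finset.sum_const_nat fun f hf => ?_
    obtain ⟨hf1, hf2⟩ := (Finset.mem_filter.1 hf).2
    have hfib : ∀ i, Nonempty ({a // f a = i} ≃ {a // g a = i}) := fun i => by
      rw [← Fintype.card_eq, Fintype.card_subtype, Fintype.card_subtype, hf1, hg]
    let σ₀ : Equiv.Perm α := Equiv.ofFiberEquiv fun i => (hfib i).some
    have hσ₀ : ∀ a, g (σ₀ a) = f a := Equiv.ofFiberEquiv_map _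
    have hstab : Fintype.card {τ : Equiv.Perm α // g ∘ τ = g} = (r !) ^ Fintype.card ι := by
      rw [DomMulAct.stabilizer_card]
      simp [Fintype.card_subtype, hg]
    rw [← hstab, Fintype.card_subtype]
    refine Finset.card_bij (fun σ _ => σ₀.symm.trans σ) ?_ ?_ ?_
    · intro σ hσ
      have h : g ∘ σ = f := (Finset.mem_filter.1 hσ).2
      refine Finset.mem_filter.2 ⟨Finset.mem_univ _, funext fun a => ?_⟩
      have := congrFun h (σ₀.symm a)
      simp only [Function.comp_apply] at this
      simp [this, ← hσ₀]
    · intro σ _ τ _ h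
      ext a
      simpa using DFunLike.congr_fun h (σ₀ a)
    · intro τ hτ
      have h : ∀ a, g (τ a) = g a := fun a => congrFun (Finset.mem_filter.1 hτ).2 a
      refine ⟨σ₀.trans τ, ?_, by ext a; simp⟩
      refine Finset.mem_filter.2 ⟨Finset.mem_filter.2 ⟨Finset.mem_univ _, fun a => ?_⟩,
        funext fun a => ?_⟩
      · simpa [h, hσ₀] using hf2 a
      · simp [h, hσ₀]
  · intro σ hσ
    have h := (Finset.mem_filter.1 hσ).2
    refine Finset.mem_filter.2 ⟨Finset.mem_univ _, fun i => ?_, h⟩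
    rw [← hg i]
    refine Finset.card_bij (fun a _ => σ a) ?_ ?_ ?_
    · intro a ha; simpa using ha
    · intro a _ b _ hab; exact σ.injective hab
    · intro b hb; exact ⟨σ.symm b, by simpa using hb, by simp⟩

/-! ### The band matrix of the Chebyshev ball -/

/-- The band `|a - b| ≤ d` with the parts overhanging the range `0, …, m - 1` reflected back into
it at both ends, which makes all row sums equal to `2 * d + 1`. -/
def foldedBand (m d a b : ℕ) : ℕ :=
  (if a ≤ b + d ∧ b ≤ a + d then 1 else 0) + (if a + b + 1 ≤ d then 1 else 0) +
    (if 2 * m ≤ a + b + 1 + d then 1 else 0)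

theorem foldedBand_comm (m d a b : ℕ) : foldedBand m d a b = foldedBand m d b a := by
  simp only [foldedBand, and_comm, Nat.add_comm a b]

theorem sum_foldedBand {m d a : ℕ} (ha : a < m) (hd : d ≤ m) :
    ∑ b : Fin m, foldedBand m d a b = 2 * d + 1 := by
  rw [Fin.sum_univ_eq_sum_range (fun b => foldedBand m d a b) m]
  simp only [foldedBand, Finset.sum_add_distrib, Finset.sum_boole, Nat.cast_id]
  have h1 : (Finset.range m).filter (fun b => a ≤ b + d ∧ b ≤ a + d) =
      Finset.Ico (a - d) (min m (a + d + 1)) := by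
    ext b; simp only [Finset.mem_filter, Finset.mem_range, Finset.mem_Ico]; omega
  have h2 : (Finset.range m).filter (fun b => a + b + 1 ≤ d) = Finset.range (d - a) := by
    ext b; simp only [Finset.mem_filter, Finset.mem_range]; omega
  have h3 : (Finset.range m).filter (fun b => 2 * m ≤ a + b + 1 + d) =
      Finset.Ico (2 * m - (a + 1 + d)) m := by
    ext b; simp only [Finset.mem_filter, Finset.mem_range, Finset.mem_Ico]; omega
  rw [h1, h2, h3, Nat.card_Ico, Finset.card_range, Nat.card_Ico]
  omega

theorem card_band_le {m : ℕ} (d a : ℕ) :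
    ∑ b : Fin m, (if (b : ℕ) ≤ a + d ∧ a ≤ b + d then 1 else 0) ≤ 2 * d + 1 := by
  rw [Fin.sum_univ_eq_sum_range (fun b => if b ≤ a + d ∧ a ≤ b + d then 1 else 0) m,
    Finset.sum_boole, Nat.cast_id]
  calc _ ≤ (Finset.Icc (a - d) (a + d)).card := by
        apply Finset.card_le_card
        intro b; simp only [Finset.mem_filter, Finset.mem_range, Finset.mem_Icc]; omega
    _ ≤ _ := by rw [Nat.card_Icc]; omega

/-- Reflection at most doubles an entry of the band for each end at which it can happen. -/
theorem foldedBand_le {m d a b : ℕ} (ha : a < m) (hb : b < m) :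
    foldedBand m d a b ≤ (if a ≤ b + d ∧ b ≤ a + d then 1 else 0) *
      2 ^ ((if b + 1 ≤ d then 1 else 0) + (if m ≤ b + d then 1 else 0)) := by
  unfold foldedBand
  split_ifs <;> omega

theorem sum_foldedBand_exponents {m d : ℕ} (hd : d ≤ m) :
    ∑ b : Fin m, ((if (b : ℕ) + 1 ≤ d then 1 else 0) + (if m ≤ (b : ℕ) + d then 1 else 0)) =
      2 * d := by
  rw [Fin.sum_univ_eq_sum_range
    (fun b => (if b + 1 ≤ d then 1 else 0) + (if m ≤ b + d then 1 else 0)) m]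
  simp only [Finset.sum_add_distrib, Finset.sum_boole, Nat.cast_id]
  have h1 : (Finset.range m).filter (fun b => b + 1 ≤ d) = Finset.range d := by
    ext b; simp only [Finset.mem_filter, Finset.mem_range]; omega
  have h2 : (Finset.range m).filter (fun b => m ≤ b + d) = Finset.Ico (m - d) m := by
    ext b; simp only [Finset.mem_filter, Finset.mem_range, Finset.mem_Ico]; omega
  rw [h1, h2, Finset.card_range, Nat.card_Ico]
  omega

/-- The upper bound for the number of permutations in the ball, from Bregman's theorem. -/
theorem permCount_band_le {m r n d : ℕ} {g : Fin n → Fin m}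
    (hg : ∀ i, (Finset.univ.filter fun a => g a = i).card = r) :
    (permCount (fun a b : Fin n => (g b : ℕ) ≤ g a + d ∧ (g a : ℕ) ≤ g b + d) : ℝ) ≤
      ((2 * d * r + r)! : ℝ) ^ ((n : ℝ) / (2 * d * r + r : ℝ)) := by
  have h := permCount_le_rpow
    (fun a b : Fin n => (g b : ℕ) ≤ g a + d ∧ (g a : ℕ) ≤ g b + d) (r := 2 * d * r + r)
    (fun a => by
      rw [Finset.card_filter, sum_comp_eq_mul_sum hg
        (fun i : Fin m => if (i : ℕ) ≤ g a + d ∧ (g a : ℕ) ≤ i + d then 1 else 0), Nat.cast_id]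
      calc _ ≤ r * (2 * d + 1) := Nat.mul_le_mul_left r (card_band_le d (g a : ℕ))
        _ = _ := by ring)
  rw [Fintype.card_fin] at h
  push_cast at h
  exact h

/-- The lower bound for the number of permutations in the ball when `d ≤ m`, from the van der
Waerden bound for the folded band. -/
theorem le_permCount_band_of_le {m r n d : ℕ} (hm : 0 < m) (hr : 0 < r) (hn : n = m * r)
    (hd : d ≤ m) {g : Fin n → Fin m} (hg : ∀ i, (Finset.univ.filter fun a => g a = i).card = r) :
    (2 * d * r + r : ℝ) ^ n * (n ! : ℝ) / ((2 : ℝ) ^ (2 * d * r) * (n : ℝ) ^ n) ≤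
      permCount (fun a b : Fin n => (g b : ℕ) ≤ g a + d ∧ (g a : ℕ) ≤ g b + d) := by
  have hnpos : 0 < n := hn ▸ Nat.mul_pos hm hr
  have : Nonempty (Fin n) := ⟨⟨0, hnpos⟩⟩
  set B : Matrix (Fin n) (Fin n) ℝ := fun a b => (foldedBand m d (g a) (g b) : ℝ) with hB
  have hrow : ∀ a, ∑ b, B a b = 2 * d * r + r := by
    intro a
    rw [sum_comp_eq_mul_sum hg (fun i : Fin m => (foldedBand m d (g a) i : ℝ)), ← Nat.cast_sum,
      sum_foldedBand (g a).2 hd]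
    push_cast; ring
  have hcol : ∀ b, ∑ a, B a b = 2 * d * r + r := by
    intro b
    rw [← hrow b]
    exact Finset.sum_congr rfl fun a _ => by rw [hB]; simp only [foldedBand_comm m d (g a)]
  have hvdw := B.le_permanent_of_nonneg (fun a b => by positivity) hrow hcol
  rw [Fintype.card_fin] at hvdw
  -- every permutation contributes at most `2 ^ (2 * d * r)`, and only those in the ball contribute
  have hprod : ∏ b : Fin n, (2 : ℝ) ^ ((if (g b : ℕ) + 1 ≤ d then 1 else 0) +
      (if m ≤ (g b : ℕ) + d then 1 else 0)) = 2 ^ (2 * d * r) := by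
    rw [Finset.prod_pow_eq_pow_sum, sum_comp_eq_mul_sum hg (fun i : Fin m =>
      (if (i : ℕ) + 1 ≤ d then 1 else 0) + (if m ≤ (i : ℕ) + d then 1 else 0)), Nat.cast_id]
    congr 1
    rw [mul_comm]
    congr 1
    exact sum_foldedBand_exponents hd
  have hle : B.permanent ≤ (permCount (fun a b : Fin n =>
      (g b : ℕ) ≤ g a + d ∧ (g a : ℕ) ≤ g b + d) : ℝ) * 2 ^ (2 * d * r) := by
    rw [permCount, Nat.card_eq_fintype_card, Fintype.card_subtype, Finset.card_filter,
      Nat.cast_sum, Finset.sum_mul, Matrix.permanent]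
    refine Finset.sum_le_sum fun σ _ => ?_
    rw [← hprod]
    have hterm : ∀ b, B (σ b) b ≤
        (if (g (σ b) : ℕ) ≤ g b + d ∧ (g b : ℕ) ≤ g (σ b) + d then 1 else 0) *
        (2 : ℝ) ^ ((if (g b : ℕ) + 1 ≤ d then 1 else 0) +
          (if m ≤ (g b : ℕ) + d then 1 else 0)) := by
      intro b
      have := foldedBand_le (d := d) (g (σ b)).2 (g b).2
      simp only [hB]
      exact_mod_cast this
    refine (Finset.prod_le_prod (fun b _ => by positivity) fun b _ => hterm b).trans ?_
    rw [Finset.prod_mul_distrib, Finset.prod_boole]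
    simp
  rw [div_le_iff₀ (by positivity)]
  have hn0 : (0 : ℝ) < (n : ℝ) ^ n := by positivity
  have h := hvdw.trans hle
  rw [← mul_div_assoc, div_le_iff₀ hn0] at h
  linarith

/-- The lower bound for the number of permutations in the ball. For `m ≤ d` the ball contains all
permutations, and the bound reduces to `(2 * d + 1) ^ m ≤ 4 ^ d * m ^ m`. -/
theorem le_permCount_band {m r n d : ℕ} (hm : 0 < m) (hr : 0 < r) (hn : n = m * r)
    {g : Fin n → Fin m}
    (hg : ∀ i, (Finset.univ.filter fun a => g a = i).card = r) :
    (2 * d * r + r : ℝ) ^ n * (n ! : ℝ) / ((2 : ℝ) ^ (2 * d * r) * (n : ℝ) ^ n) ≤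
      permCount (fun a b : Fin n => (g b : ℕ) ≤ g a + d ∧ (g a : ℕ) ≤ g b + d) := by
  rcases le_total d m with hd | hd
  · exact le_permCount_band_of_le hm hr hn hd hg
  · have hall : permCount (fun a b : Fin n => (g b : ℕ) ≤ g a + d ∧ (g a : ℕ) ≤ g b + d) = n ! := by
      have : ∀ e : Fin n ≃ Fin n, ∀ a, (g (e a) : ℕ) ≤ g a + d ∧ (g a : ℕ) ≤ g (e a) + d :=
        fun e a => by
          have h1 := (g (e a)).2
          have h2 := (g a).2
          omega
      rw [permCount, Nat.card_congr (Equiv.subtypeUnivEquiv this), Nat.card_eq_fintype_card,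
        Fintype.card_perm, Fintype.card_fin]
    rw [hall]
    have hm' : (0 : ℝ) < m := by exact_mod_cast hm
    have hr' : (0 : ℝ) < r := by exact_mod_cast hr
    have hd' : (m : ℝ) ≤ d := by exact_mod_cast hd
    have hn' : (n : ℝ) = m * r := by rw [hn]; push_cast; ring
    have hbern : (2 * d + 1 : ℝ) / m ≤ (4 : ℝ) ^ ((d : ℝ) / m) := by
      have h := one_add_mul_self_le_rpow_one_add (s := 3) (by norm_num)
        (p := (d : ℝ) / m) (by rwa [le_div_iff₀ hm', one_mul])
      refine le_trans ?_ (h.trans_eq (by norm_num))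
      rw [div_le_iff₀ hm']
      have : (d : ℝ) / m * m = d := by field_simp
      have h1 : (1 : ℝ) ≤ m := by exact_mod_cast hm
      nlinarith
    have hpow : ((2 * d + 1 : ℝ) / m) ^ m ≤ (4 : ℝ) ^ d := by
      refine (pow_le_pow_left₀ (by positivity) hbern m).trans_eq ?_
      rw [← Real.rpow_natCast, ← Real.rpow_mul (by norm_num), div_mul_cancel₀ _ hm'.ne',
        Real.rpow_natCast]
    have hkey : (2 * d * r + r : ℝ) ^ n ≤ (2 : ℝ) ^ (2 * d * r) * (n : ℝ) ^ n := by
      have h1 : (2 * d * r + r : ℝ) = (2 * d + 1 : ℝ) / m * n := by rw [hn']; field_simp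
      rw [h1, mul_pow]
      refine mul_le_mul_of_nonneg_right ?_ (by positivity)
      rw [hn, pow_mul, pow_mul, pow_mul]
      refine pow_le_pow_left₀ (by positivity) (hpow.trans_eq (by norm_num)) r
    have hn0 : (0 : ℝ) < n := by rw [hn']; positivity
    rw [div_le_iff₀ (by positivity), mul_comm]
    exact mul_le_mul_of_nonneg_left hkey (by positivity)

/-! ### Multipermutations as arrangements -/

/-- The binary matrix whose column `j` has its one in row `f j`. -/
def arrangementMatrix {m n : ℕ} (f : Fin n → Fin m) : Matrix (Fin m) (Fin n) ℝ :=
  fun i j => if f j = i then 1 else 0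

theorem arrangementMatrix_injective {m n : ℕ} :
    Function.Injective (arrangementMatrix : (Fin n → Fin m) → Matrix (Fin m) (Fin n) ℝ) := by
  intro f f' h
  funext j
  have := congrFun (congrFun h (f j)) j
  simp only [arrangementMatrix, if_true] at this
  by_contra hne
  rw [if_neg (Ne.symm hne)] at this
  exact one_ne_zero this

theorem initialVector_vecMul_arrangementMatrix {m n : ℕ} (f : Fin n → Fin m) :
    initialVector m ᵥ* arrangementMatrix f = fun j => ((f j : ℕ) : ℝ) + 1 := by
  funext j
  simp [Matrix.vecMul, dotProduct, arrangementMatrix, initialVector]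

theorem mem_multipermutationMatrices_iff {m n r : ℕ} (X : Matrix (Fin m) (Fin n) ℝ) :
    X ∈ multipermutationMatrices (fun _ : Fin m => r) ↔
      ∃ f : Fin n → Fin m, (∀ i, (Finset.univ.filter fun j => f j = i).card = r) ∧
        arrangementMatrix f = X := by
  constructor
  · rintro ⟨h01, hcol, hrow⟩
    have hone : ∀ j, ∃ i, X i j = 1 := by
      intro j
      by_contra hne
      push Not at hne
      have := hcol j
      rw [Finset.sum_eq_zero fun i _ => (h01 i j).resolve_right (hne i)] at this
      exact zero_ne_one this
    choose f hf using hone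
    have hfX : arrangementMatrix f = X := by
      ext i j
      rw [arrangementMatrix]
      split_ifs with h
      · rw [← h, hf]
      · refine ((h01 i j).resolve_right fun h1 => ?_).symm
        have hle : X (f j) j + X i j ≤ ∑ i, X i j := by
          rw [← Finset.sum_pair (f := fun k => X k j) h]
          exact Finset.sum_le_sum_of_subset_of_nonneg (Finset.subset_univ _) fun k _ _ => by
            rcases h01 k j with h0 | h0 <;> simp [h0]
        rw [hf, h1, hcol] at hle
        norm_num at hle
    refine ⟨f, fun i => ?_, hfX⟩
    have := hrow i
    rw [← hfX] at this
    simp only [arrangementMatrix, Finset.sum_boole] at this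
    exact_mod_cast this
  · rintro ⟨f, hf, rfl⟩
    refine ⟨fun i j => ?_, fun j => ?_, fun i => ?_⟩
    · rw [arrangementMatrix]; split_ifs <;> simp
    · simp [arrangementMatrix]
    · simp only [arrangementMatrix, Finset.sum_boole, hf]

/-- A multipermutation is given by a map `g` all of whose fibres have `r` elements. -/
theorem exists_arrangement_of_mem_multipermutations {m n r : ℕ} {y : Fin n → ℝ}
    (hy : y ∈ multipermutations (fun _ : Fin m => r) (initialVector m)) :
    ∃ g : Fin n → Fin m, (∀ i, (Finset.univ.filter fun j => g j = i).card = r) ∧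
      ∀ j, y j = ((g j : ℕ) : ℝ) + 1 := by
  classical
  have hy' : (Finset.univ : Finset (Fin n)).val.map y =
    ∑ i : Fin m, Multiset.replicate r (initialVector m i) := hy
  have hinj : Function.Injective (initialVector m) := by
    intro i i' h
    simpa [initialVector, Fin.ext_iff] using h
  have hex : ∀ j, ∃ i, y j = initialVector m i := by
    intro j
    have : y j ∈ (Finset.univ : Finset (Fin n)).val.map y :=
      Multiset.mem_map_of_mem _ (Finset.mem_univ j)
    rw [hy', Multiset.mem_sum] at this
    obtain ⟨i, _, hi⟩ := this
    exact ⟨i, Multiset.eq_of_mem_replicate hi⟩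
  choose g hg using hex
  refine ⟨g, fun i => ?_, hg⟩
  have h := congrArg (Multiset.count (initialVector m i)) hy'
  rw [Multiset.count_map, Multiset.count_sum'] at h
  simp only [Multiset.count_replicate, hinj.eq_iff, Finset.sum_ite_eq', Finset.mem_univ,
    if_true] at h
  rw [← h, ← Finset.filter_val, Finset.card_def]
  congr 2
  ext j
  simp [hg, hinj.eq_iff, eq_comm]

theorem chebyshevDist_arrangement_le_iff {m n d : ℕ} (f g : Fin n → Fin m) {y : Fin n → ℝ}
    (hy : ∀ j, y j = ((g j : ℕ) : ℝ) + 1) :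
    chebyshevDist (initialVector m ᵥ* arrangementMatrix f) y ≤ d ↔
      ∀ j, (f j : ℕ) ≤ g j + d ∧ (g j : ℕ) ≤ f j + d := by
  rw [chebyshevDist_eq_dist, dist_pi_le_iff (Nat.cast_nonneg d),
    initialVector_vecMul_arrangementMatrix]
  refine forall_congr' fun j => ?_
  rw [hy, Real.dist_eq, add_sub_add_right_eq_sub, abs_le]
  constructor
  · rintro ⟨h1, h2⟩
    constructor
    · have : ((f j : ℕ) : ℝ) ≤ ((g j + d : ℕ) : ℝ) := by push_cast; linarith
      exact_mod_cast this
    · have : ((g j : ℕ) : ℝ) ≤ ((f j + d : ℕ) : ℝ) := by push_cast; linarith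
      exact_mod_cast this
  · rintro ⟨h1, h2⟩
    have h1' : ((f j : ℕ) : ℝ) ≤ ((g j + d : ℕ) : ℝ) := by exact_mod_cast h1
    have h2' : ((g j : ℕ) : ℝ) ≤ ((f j + d : ℕ) : ℝ) := by exact_mod_cast h2
    push_cast at h1' h2'
    constructor <;> linarith

/-- The number of multipermutation matrices in a Chebyshev ball, in terms of permutations. -/
theorem permCount_eq_mul_ballCount {m n r d : ℕ} {g : Fin n → Fin m} {y : Fin n → ℝ}
    (hg : ∀ i, (Finset.univ.filter fun j => g j = i).card = r)
    (hy : ∀ j, y j = ((g j : ℕ) : ℝ) + 1) :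
    permCount (fun a b : Fin n => (g b : ℕ) ≤ g a + d ∧ (g a : ℕ) ≤ g b + d) =
      (r !) ^ m * ballCount (initialVector m) y d
        (multipermutationMatrices fun _ : Fin m => r) := by
  classical
  rw [permCount_eq_mul_card hg fun i i' : Fin m => (i : ℕ) ≤ i' + d ∧ (i' : ℕ) ≤ i + d,
    Fintype.card_fin]
  congr 1
  rw [ballCount, ← Set.ncard_coe_finset,
    ← Set.ncard_image_of_injective _ arrangementMatrix_injective]
  congr 1
  ext X
  simp only [Set.mem_image, Finset.coe_filter, Finset.mem_univ, true_and, Set.mem_ofPred_eq,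
    mem_multipermutationMatrices_iff]
  constructor
  · rintro ⟨f, ⟨hf1, hf2⟩, rfl⟩
    exact ⟨⟨f, hf1, rfl⟩, (chebyshevDist_arrangement_le_iff f g hy).2 hf2⟩
  · rintro ⟨⟨f, hf1, rfl⟩, h⟩
    exact ⟨f, ⟨hf1, (chebyshevDist_arrangement_le_iff f g hy).1 h⟩, rfl⟩

/-- The bounds for the number of multipermutation matrices in a Chebyshev ball. -/
theorem ballCount_multipermutationMatrices_bounds {m r n : ℕ} (d : ℕ) (hm : 0 < m) (hr : 0 < r)
    (hn : n = m * r) {y : Fin n → ℝ}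
    (hy : y ∈ multipermutations (fun _ : Fin m => r) (initialVector m)) :
    (2 * d * r + r : ℝ) ^ n * (n ! : ℝ) /
        ((2 : ℝ) ^ (2 * d * r) * (n : ℝ) ^ n * (r ! : ℝ) ^ m) ≤
      (ballCount (initialVector m) y d (multipermutationMatrices fun _ : Fin m => r) : ℝ) ∧
    (ballCount (initialVector m) y d (multipermutationMatrices fun _ : Fin m => r) : ℝ) ≤
      ((2 * d * r + r)! : ℝ) ^ ((n : ℝ) / (2 * d * r + r : ℝ)) / (r ! : ℝ) ^ m := by
  obtain ⟨g, hg, hgy⟩ := exists_arrangement_of_mem_multipermutations hy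
  have hcount := permCount_eq_mul_ballCount (d := d) hg hgy
  have hpos : (0 : ℝ) < (r ! : ℝ) ^ m := by positivity
  have hlow := le_permCount_band (d := d) hm hr hn hg
  have hupp := permCount_band_le (d := d) hg
  rw [hcount] at hlow hupp
  push_cast at hlow hupp
  constructor
  · rw [← div_div, div_le_iff₀ hpos, mul_comm _ ((r ! : ℝ) ^ m)]
    exact hlow
  · rw [le_div_iff₀ hpos, mul_comm]
    exact hupp

/-! ### Averaging over constraint sets -/

/-- Double counting: if every matrix of `C` satisfies exactly `c` of the constraints in `S`, then
the expected size of a ball in the constrained code is the fraction `c / S.card` of its size in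
`C`. -/
theorem expect_ballCount {m n : ℕ} {β : Type*} (t : Fin m → ℝ) (y : Fin n → ℝ) (d : ℕ)
    {C : Set (Matrix (Fin m) (Fin n) ℝ)} (hC : C.Finite) (S : Finset β)
    (sat : Matrix (Fin m) (Fin n) ℝ → β → Prop) [∀ X, DecidablePred (sat X)] {c : ℕ}
    (hc : ∀ X ∈ C, (S.filter (sat X)).card = c) :
    (𝔼 Z ∈ S, (ballCount t y d {X | X ∈ C ∧ sat X Z} : ℝ)) =
      (c : ℝ) / (S.card : ℝ) * ballCount t y d C := by
  classical
  have hfin : {X | X ∈ C ∧ chebyshevDist (t ᵥ* X) y ≤ d}.Finite := hC.subset fun X hX => hX.1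
  set B := hfin.toFinset with hB
  have hball : ballCount t y d C = B.card := by
    rw [ballCount, Set.ncard_eq_toFinset_card _ hfin]
  have hsub : ∀ Z, ballCount t y d {X | X ∈ C ∧ sat X Z} = (B.filter fun X => sat X Z).card := by
    intro Z
    rw [ballCount, ← Set.ncard_coe_finset]
    congr 1
    ext X
    simp only [Set.mem_ofPred_eq, Finset.coe_filter, hB, Set.Finite.mem_toFinset]
    tauto
  have hdouble : ∑ Z ∈ S, (B.filter fun X => sat X Z).card = B.card * c := by
    rw [← Finset.sum_const_nat (s := B) (f := fun X => (S.filter (sat X)).card)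
      (fun X hX => hc X ((Set.Finite.mem_toFinset hfin).1 hX).1)]
    exact (Finset.sum_card_bipartiteAbove_eq_sum_card_bipartiteBelow sat).symm
  rw [Finset.expect_eq_sum_div_card, hball]
  simp only [hsub]
  rw [← Nat.cast_sum, hdouble]
  push_cast
  ring

/-- The positions of the ones of `arrangementMatrix f`. -/
def onePositions {m n : ℕ} (f : Fin n → Fin m) : Finset (Fin m × Fin n) :=
  Finset.univ.image fun j => (f j, j)

theorem mem_onePositions {m n : ℕ} {f : Fin n → Fin m} {p : Fin m × Fin n} :
    p ∈ onePositions f ↔ f p.2 = p.1 := by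
  simp [onePositions, Prod.ext_iff]

theorem card_onePositions {m n : ℕ} (f : Fin n → Fin m) : (onePositions f).card = n := by
  rw [onePositions, Finset.card_image_of_injective _ fun a b h => (Prod.ext_iff.1 h).2]
  simp

theorem card_compl_onePositions {m n : ℕ} (f : Fin n → Fin m) :
    (onePositions f)ᶜ.card = m * n - n := by
  rw [Finset.card_compl, card_onePositions]; simp

/-- An arrangement satisfies a set of zero constraints exactly when the set avoids its ones. -/
theorem card_zeroConstraintSets_filter {m n r κ : ℕ} {X : Matrix (Fin m) (Fin n) ℝ}
    (hX : X ∈ multipermutationMatrices fun _ : Fin m => r)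
    [DecidablePred fun Z : Finset (Fin m × Fin n) => ∀ p ∈ Z, X p.1 p.2 = 0] :
    ((zeroConstraintSets m n κ).filter fun Z => ∀ p ∈ Z, X p.1 p.2 = 0).card =
      (m * n - n).choose κ := by
  obtain ⟨f, -, rfl⟩ := (mem_multipermutationMatrices_iff X).1 hX
  rw [← card_compl_onePositions f, ← Finset.card_powersetCard]
  congr 1
  ext Z
  simp only [zeroConstraintSets, Finset.mem_filter, Finset.mem_powersetCard, Finset.subset_univ,
    true_and]
  rw [and_comm]
  refine and_congr_left fun _ => forall₂_congr fun p _ => ?_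
  rw [Finset.mem_compl, mem_onePositions, arrangementMatrix]
  simp

/-- An arrangement satisfies a set of equality constraints exactly when each of its pairs lies
within the zeros or within the ones. -/
theorem card_equalityConstraintSets_filter {m n r ι : ℕ} {X : Matrix (Fin m) (Fin n) ℝ}
    (hX : X ∈ multipermutationMatrices fun _ : Fin m => r)
    [DecidablePred fun E : Finset (Sym2 (Fin m × Fin n)) =>
      ∀ p q : Fin m × Fin n, s(p, q) ∈ E → X p.1 p.2 = X q.1 q.2] :
    ((equalityConstraintSets m n ι).filter fun E =>
      ∀ p q : Fin m × Fin n, s(p, q) ∈ E → X p.1 p.2 = X q.1 q.2).card =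
      ((n * m - n).choose 2 + n.choose 2).choose ι := by
  obtain ⟨f, -, rfl⟩ := (mem_multipermutationMatrices_iff X).1 hX
  set U := onePositions f
  set A := U.offDiag.image (Function.uncurry Sym2.mk) with hA
  set A' := Uᶜ.offDiag.image (Function.uncurry Sym2.mk) with hA'
  have hmem : ∀ (V : Finset (Fin m × Fin n)) p q,
      s(p, q) ∈ V.offDiag.image (Function.uncurry Sym2.mk) ↔ p ∈ V ∧ q ∈ V ∧ p ≠ q := by
    intro V p q
    simp only [Finset.mem_image, Finset.mem_offDiag]
    constructor
    · rintro ⟨⟨a, b⟩, ⟨ha, hb, hab⟩, h⟩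
      rcases Sym2.eq_iff.1 h with ⟨rfl, rfl⟩ | ⟨rfl, rfl⟩
      · exact ⟨ha, hb, hab⟩
      · exact ⟨hb, ha, hab.symm⟩
    · intro h
      exact ⟨(p, q), h, rfl⟩
  have hdisj : Disjoint A' A := by
    rw [Finset.disjoint_left]
    intro e
    induction e using Sym2.ind with
    | _ p q =>
      intro h1 h2
      exact (Finset.mem_compl.1 ((hmem _ p q).1 h1).1) ((hmem _ p q).1 h2).1
  have hcard : (A' ∪ A).card = (n * m - n).choose 2 + n.choose 2 := by
    rw [Finset.card_union_of_disjoint hdisj, hA, hA', Sym2.card_image_offDiag,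
      Sym2.card_image_offDiag, card_compl_onePositions, card_onePositions, Nat.mul_comm m n]
  rw [← hcard, ← Finset.card_powersetCard]
  congr 1
  ext E
  simp only [equalityConstraintSets, Finset.mem_filter, Finset.mem_powersetCard]
  have heq : ∀ p q : Fin m × Fin n, arrangementMatrix f p.1 p.2 = arrangementMatrix f q.1 q.2 ↔
      (p ∈ U ↔ q ∈ U) := by
    intro p q
    rw [mem_onePositions, mem_onePositions, arrangementMatrix, arrangementMatrix]
    by_cases h1 : f p.2 = p.1 <;> by_cases h2 : f q.2 = q.1 <;> simp [h1, h2]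
  constructor
  · rintro ⟨⟨hdiag, hEc⟩, hE⟩
    refine ⟨fun e he => ?_, hEc⟩
    induction e using Sym2.ind with
    | _ p q =>
      have hne : p ≠ q := by simpa using hdiag he
      have := (heq p q).1 (hE p q he)
      rw [Finset.mem_union, hmem, hmem, Finset.mem_compl, Finset.mem_compl]
      tauto
  · rintro ⟨hsub, hEc⟩
    refine ⟨⟨fun e he => ?_, hEc⟩, fun p q he => ?_⟩
    · have := hsub he
      induction e using Sym2.ind with
      | _ p q =>
        rw [Finset.mem_union, hmem, hmem] at this
        have hne : p ≠ q := by tauto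
        simpa using hne
    · have := hsub he
      rw [Finset.mem_union, hmem, hmem, Finset.mem_compl, Finset.mem_compl] at this
      rw [heq]
      tauto

theorem mainTheorem4 (m r n d : ℕ) (hm : 0 < m) (hr : 0 < r) (hn : n = m * r)
    (y : Fin n → ℝ) (hy : y ∈ multipermutations (fun _ : Fin m => r) (initialVector m)) :
    (∀ κ : ℕ, κ ≤ m * n →
      (((m * n - n).choose κ : ℝ) / ((zeroConstraintSets m n κ).card : ℝ)) *
          ((2 * d * r + r : ℝ) ^ n * (n ! : ℝ) /
            ((2 : ℝ) ^ (2 * d * r) * (n : ℝ) ^ n * (r ! : ℝ) ^ m))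
        ≤ (𝔼 Z ∈ zeroConstraintSets m n κ,
            (ballCount (initialVector m) y d (zeroConstrained (fun _ : Fin m => r) Z) : ℝ)) ∧
      (𝔼 Z ∈ zeroConstraintSets m n κ,
            (ballCount (initialVector m) y d (zeroConstrained (fun _ : Fin m => r) Z) : ℝ))
        ≤ (((m * n - n).choose κ : ℝ) / ((zeroConstraintSets m n κ).card : ℝ)) *
          (((2 * d * r + r)! : ℝ) ^ ((n : ℝ) / (2 * d * r + r : ℝ)) / (r ! : ℝ) ^ m)) ∧
    (∀ ι : ℕ, ι ≤ (n * m).choose 2 →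
      ((((n * m - n).choose 2 + n.choose 2).choose ι : ℝ) /
            ((equalityConstraintSets m n ι).card : ℝ)) *
          ((2 * d * r + r : ℝ) ^ n * (n ! : ℝ) /
            ((2 : ℝ) ^ (2 * d * r) * (n : ℝ) ^ n * (r ! : ℝ) ^ m))
        ≤ (𝔼 E ∈ equalityConstraintSets m n ι,
            (ballCount (initialVector m) y d (equalityConstrained (fun _ : Fin m => r) E) : ℝ)) ∧
      (𝔼 E ∈ equalityConstraintSets m n ι,
            (ballCount (initialVector m) y d (equalityConstrained (fun _ : Fin m => r) E) : ℝ))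
        ≤ ((((n * m - n).choose 2 + n.choose 2).choose ι : ℝ) /
            ((equalityConstraintSets m n ι).card : ℝ)) *
          (((2 * d * r + r)! : ℝ) ^ ((n : ℝ) / (2 * d * r + r : ℝ)) / (r ! : ℝ) ^ m)) := by

  classical
  obtain ⟨hlow, hupp⟩ := ballCount_multipermutationMatrices_bounds d hm hr hn hy
  have hfin : (multipermutationMatrices (fun _ : Fin m => r) :
    Set (Matrix (Fin m) (Fin n) ℝ)).Finite := multipermutationMatrices_finite _
  constructor
  · intro κ _
    have h := expect_ballCount (initialVector m) y d hfin (zeroConstraintSets m n κ)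
      (fun X Z => ∀ p ∈ Z, X p.1 p.2 = 0) (fun X hX => card_zeroConstraintSets_filter hX)
    change (𝔼 Z ∈ zeroConstraintSets m n κ,
      (ballCount (initialVector m) y d (zeroConstrained (fun _ : Fin m => r) Z) : ℝ)) = _ at h
    rw [h]
    exact ⟨mul_le_mul_of_nonneg_left hlow (by positivity),
      mul_le_mul_of_nonneg_left hupp (by positivity)⟩
  · intro ι _
    have h := expect_ballCount (initialVector m) y d hfin (equalityConstraintSets m n ι)
      (fun X E => ∀ p q : Fin m × Fin n, s(p, q) ∈ E → X p.1 p.2 = X q.1 q.2)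
      (fun X hX => card_equalityConstraintSets_filter hX)
    change (𝔼 E ∈ equalityConstraintSets m n ι,
      (ballCount (initialVector m) y d (equalityConstrained (fun _ : Fin m => r) E) : ℝ)) = _ at h
    rw [h]
    exact ⟨mul_le_mul_of_nonneg_left hlow (by positivity),
      mul_le_mul_of_nonneg_left hupp (by positivity)⟩
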